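/- Let $\chi_3$ and $\chi_4$ be the Dirichlet characters modulo $48$ induced from the nontrivial characters modulo $3$ and modulo $4$ (so $\chi_3(-1)=\chi_4(-1)=-1$). For a Dirichlet character $\chi$ modulo $48$ let $S_3(\Gamma_0(48),\chi)$ be the space of cusp forms $f$ of weight $3$ for $\Gamma_1(48)$ with $f\left(\frac{az+b}{cz+d}\right)=\chi(d)(cz+d)^3f(z)$ for all $\begin{pmatrix}a&b\\c&d\end{pmatrix}\in\Gamma_0(48)$, and write $q=e^{2\pi i z}$. Let $f_{20},f_{22}\in S_3(\Gamma_0(48),\chi_3)$ and $f_{35},f_{38},f_{41},f_{44}\in S_3(\Gamma_0(48),\chi_4)$ be the cusp forms (members of a basis of the cuspidal spaces) determined by the following initial $q$-expansions: \begin{align*} f_{20}={}&3q+q^{3}+10q^{7}-5q^{9}-2q^{13}-32q^{15}-30q^{19}-18q^{21}+11q^{25}+73q^{27}+90q^{31}+32q^{33}\\ &+14q^{37}-86q^{39}-142q^{43}+64q^{45}-71q^{49}+128q^{51}+64q^{55}-74q^{57}-98q^{61}-102q^{63}\\ &-126q^{67}-64q^{69}+O(q^{73}),\\ f_{22}={}&-32q^{3}-64q^{5}+64q^{9}+64q^{11}+64q^{15}+256q^{17}-192q^{21}-128q^{23}+160q^{27}-192q^{29}-64q^{33}\\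 &-384q^{35}-320q^{39}-384q^{41}+448q^{45}+768q^{47}-256q^{51}+704q^{53}+64q^{57}+832q^{59}+384q^{63}\\ &-640q^{65}+128q^{69}-1408q^{71}+O(q^{73}),\\ f_{35}={}&2q-2q^{2}-4q^{4}-4q^{5}+6q^{6}+16q^{8}-6q^{9}+4q^{10}-12q^{12}+4q^{13}-24q^{14}-16q^{16}+20q^{17}\\ &+6q^{18}+8q^{20}+24q^{21}+24q^{22}+O(q^{25}),\\ f_{38}={}&-2q-4q^{2}+6q^{3}+16q^{4}+4q^{5}-12q^{6}-24q^{7}-16q^{8}+6q^{9}+8q^{10}+24q^{11}-4q^{13}+48q^{14}\\ &-12q^{15}-32q^{16}-20q^{17}+12q^{18}+72q^{19}-32q^{20}-24q^{21}-48q^{22}-96q^{23}+48q^{24}+O(q^{25}),\\ f_{41}={}&q-6q^{5}+9q^{9}+10q^{13}-30q^{17}+O(q^{25}),\\ f_{44}={}&-6q^{3}-24q^{7}+72q^{11}-36q^{15}+24q^{19}+O(q^{25}). \end{align*} Write $[j]_n$ for the coefficient of $q^n$ in $f_j$. Then for all integers $n\ge 0$: 1. if $n\equiv 1 \bmod 4$,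 then $[44]_n=0$; 2. if $n\not\equiv 1\bmod 4$, then $[41]_n=0$; 3. if $n\equiv 1\bmod 4$, then $[35]_n=-[38]_n$; 4. if $n\equiv 1\bmod 3$, then $[22]_n=0$; 5. if $n\equiv 2\bmod 3$, then $[20]_n=0$. -/

import Mathlib

open scoped MatrixGroups ModularForm CongruenceSubgroup

namespace LevelFortyEight

noncomputable section

/-- The quadratic character modulo `3` (so `χ₃(1) = 1`, `χ₃(-1) = -1`), induced to modulus `48`. -/
def chi3 : DirichletCharacter ℂ 48 :=
  DirichletCharacter.changeLevel (show 3 ∣ 48 by norm_num)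
    ((quadraticChar (ZMod 3)).ringHomComp (Int.castRingHom ℂ))

/-- The nontrivial character modulo `4` (so `χ₄(1) = 1`, `χ₄(-1) = -1`), induced to modulus `48`. -/
def chi4 : DirichletCharacter ℂ 48 :=
  DirichletCharacter.changeLevel (show 4 ∣ 48 by norm_num)
    (ZMod.χ₄.ringHomComp (Int.castRingHom ℂ))

/-- `S_k(Γ₀(N), χ)`: the cusp forms `f` of weight `k` for `Γ₁(N)` such that
`f((az + b)/(cz + d)) = χ(d) (cz + d)^k f(z)` for all `(a, b; c, d)` in `Γ₀(N)`.
As `(f ∣[k] γ)(z) = (cz + d)^(-k) f((az + b)/(cz + d))`, the condition is `f ∣[k] γ = χ(d) f`. -/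
def cuspFormsWithCharacter (N : ℕ) (k : ℤ) (χ : DirichletCharacter ℂ N) :
    Set (CuspForm (CongruenceSubgroup.Gamma1 N : Subgroup (GL (Fin 2) ℝ)) k) :=
  {f | ∀ γ ∈ CongruenceSubgroup.Gamma0 N,
    (⇑f) ∣[k] γ = χ ((γ 1 1 : ℤ) : ZMod N) • (⇑f)}

/-- The coefficient of `q^n` in `f(z) = ∑ n, c(n) q^n`, where `q = exp(2πiz)`. -/
def qCoeff {N : ℕ} {k : ℤ}
    (f : CuspForm (CongruenceSubgroup.Gamma1 N : Subgroup (GL (Fin 2) ℝ)) k) (n : ℕ) : ℂ :=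
  (UpperHalfPlane.qExpansion 1 f).coeff n

/-- `f` lies in `S_3(Γ₀(48), χ)` and its `q`-expansion begins with the coefficients
`L = [c(0), c(1), …, c(B)]`. The lists below have `B ≥ 24 = (3/12)·[SL₂(ℤ) : Γ₀(48)]`, so each of
them is satisfied by at most one `f`. -/
def IsCuspFormWithExpansion (χ : DirichletCharacter ℂ 48) (L : List ℤ)
    (f : CuspForm (CongruenceSubgroup.Gamma1 48 : Subgroup (GL (Fin 2) ℝ)) 3) : Prop :=
  f ∈ cuspFormsWithCharacter 48 3 χ ∧
    ∀ (n : ℕ) (hn : n < L.length), qCoeff f n = (L[n] : ℂ)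

end

/-- `f₂₀ = 3q + q³ + 10q⁷ - 5q⁹ - 2q¹³ - …` -/
def coeffs20 : List ℤ :=
  [0, 3, 0, 1, 0, 0, 0, 10, 0, -5, 0, 0, 0, -2, 0, -32, 0, 0, 0, -30, 0, -18, 0, 0,
   0, 11, 0, 73, 0, 0, 0, 90, 0, 32, 0, 0, 0, 14, 0, -86, 0, 0, 0, -142, 0, 64, 0, 0,
   0, -71, 0, 128, 0, 0, 0, 64, 0, -74, 0, 0, 0, -98, 0, -102, 0, 0, 0, -126, 0, -64, 0, 0,
   0]

/-- `f₂₂ = -32q³ - 64q⁵ + 64q⁹ + 64q¹¹ + 64q¹⁵ + …` -/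
def coeffs22 : List ℤ :=
  [0, 0, 0, -32, 0, -64, 0, 0, 0, 64, 0, 64, 0, 0, 0, 64, 0, 256, 0, 0, 0, -192, 0, -128,
   0, 0, 0, 160, 0, -192, 0, 0, 0, -64, 0, -384, 0, 0, 0, -320, 0, -384, 0, 0, 0, 448, 0, 768,
   0, 0, 0, -256, 0, 704, 0, 0, 0, 64, 0, 832, 0, 0, 0, 384, 0, -640, 0, 0, 0, 128, 0, -1408,
   0]

/-- `f₃₅ = 2q - 2q² - 4q⁴ - 4q⁵ + 6q⁶ + …` -/
def coeffs35 : List ℤ :=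
  [0, 2, -2, 0, -4, -4, 6, 0, 16, -6, 4, 0, -12, 4, -24, 0, -16, 20, 6, 0, 8, 24, 24, 0, 0]

/-- `f₃₈ = -2q - 4q² + 6q³ + 16q⁴ + 4q⁵ - …` -/
def coeffs38 : List ℤ :=
  [0, -2, -4, 6, 16, 4, -12, -24, -16, 6, 8, 24, 0, -4, 48, -12, -32, -20, 12, 72, -32, -24,
   -48, -96, 48]

/-- `f₄₁ = q - 6q⁵ + 9q⁹ + 10q¹³ - 30q¹⁷ + …` -/
def coeffs41 : List ℤ :=
  [0, 1, 0, 0, 0, -6, 0, 0, 0, 9, 0, 0, 0, 10, 0, 0, 0, -30, 0, 0, 0, 0, 0, 0, 0]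

/-- `f₄₄ = -6q³ - 24q⁷ + 72q¹¹ - 36q¹⁵ + 24q¹⁹ + …` -/
def coeffs44 : List ℤ :=
  [0, 0, 0, -6, 0, 0, 0, -24, 0, 0, 0, 72, 0, 0, 0, -36, 0, 0, 0, 24, 0, 0, 0, 0, 0]

end LevelFortyEight

/-! Each claim says that the coefficients of some `f` (for the third, of `f35 + f38`) vanish on
residue classes modulo `M = 3` or `4`. Averaging the translates `f(z + j/M)` against roots of unity
isolates one class. Units modulo `M` are self-inverse, so conjugation by these translations
preserves `Γ₀(M P)` when `M ∣ P`, and the projection `g` keeps the character (`translateSum_slash`).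
As `χ` is quadratic, `g²` has trivial character and weight `6` on `Γ₀(48)` or `Γ₀(144)`. The listed
coefficients make `g²` vanish to order `50 > 6·96/12` or `146 > 6·288/12`, so the Sturm bound gives
`g = 0`. That bound follows from level one by taking norms. -/

open scoped Pointwise
open UpperHalfPlane Filter Asymptotics Function.Periodic
open Matrix.GeneralLinearGroup (upperRightHom)

/-! ### Order of vanishing at `i∞` and `q`-coefficients. -/

section QExpansionOrder

variable {f : ℍ → ℂ} {c : ℕ → ℂ}

/-- A `q`-series starting in degree `n` is `O(q^n)` at `i∞`. -/
theorem isBigO_qParam_pow_of_hasSum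
    (hf : ∀ τ : ℍ, HasSum (fun m ↦ c m * qParam 1 τ ^ m) (f τ)) {n : ℕ}
    (hc : ∀ m < n, c m = 0) :
    f =O[atImInfty] fun τ : ℍ ↦ qParam 1 τ ^ n := by
  have hq (τ : ℍ) : qParam 1 (τ : ℂ) ^ n ≠ 0 := pow_ne_zero _ (qParam_ne_zero _)
  have hsum (τ : ℍ) :
      HasSum (fun m ↦ c (m + n) • qParam 1 (τ : ℂ) ^ m) (f τ / qParam 1 (τ : ℂ) ^ n) := by
    have h := (hasSum_nat_add_iff' n).mpr (hf τ)
    rw [Finset.sum_eq_zero fun m hm ↦ by rw [hc m (Finset.mem_range.mp hm), zero_mul],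
      sub_zero] at h
    refine (h.div_const (qParam 1 (τ : ℂ) ^ n)).congr_fun fun m ↦ ?_
    rw [pow_add, ← mul_assoc, mul_div_cancel_right₀ _ (hq τ), smul_eq_mul]
  have hbdd : (fun τ : ℍ ↦ f τ / qParam 1 (τ : ℂ) ^ n) =O[atImInfty] (1 : ℍ → ℝ) :=
    isBoundedAtImInfty_of_hasSum_qExpansion one_pos hsum
  have := (hbdd.trans (isBigO_const_const (1 : ℝ) (one_ne_zero (α := ℂ)) atImInfty)).mul (isBigO_refl (fun τ : ℍ ↦ qParam 1 (τ : ℂ) ^ n) atImInfty)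
  simpa [div_mul_cancel₀ _ (hq _)] using this

/-- If a `q`-series is `O(q^n)` at `i∞`, its coefficients in degrees below `n` vanish. -/
theorem eq_zero_of_isBigO_qParam_pow
    (hf : ∀ τ : ℍ, HasSum (fun m ↦ c m * qParam 1 τ ^ m) (f τ)) {n : ℕ}
    (hO : f =O[atImInfty] fun τ : ℍ ↦ qParam 1 τ ^ n) {m : ℕ} (hm : m < n) : c m = 0 := by
  have hqt : Tendsto (fun τ : ℍ ↦ qParam 1 (τ : ℂ)) atImInfty (nhds 0) :=
    qParam_tendsto_atImInfty one_pos
  have hpow {a b : ℕ} (hab : a ≤ b) :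
      (fun τ : ℍ ↦ qParam 1 (τ : ℂ) ^ b) =O[atImInfty] fun τ : ℍ ↦ qParam 1 (τ : ℂ) ^ a :=
    by
    obtain ⟨d, rfl⟩ := Nat.exists_eq_add_of_le hab
    have hd : (fun τ : ℍ ↦ qParam 1 (τ : ℂ) ^ d) =O[atImInfty] (fun _ ↦ (1 : ℂ)) :=
      (hqt.pow d).isBigO_one ℂ
    simpa [pow_add] using (isBigO_refl (fun τ : ℍ ↦ qParam 1 (τ : ℂ) ^ a) atImInfty).mul hd
  induction m using Nat.strong_induction_on with | _ m ih =>
  -- By induction `c m * q^m` is the leading term. Both it and `f` minus it turn out to be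
  -- `O(q^(m+1))`, so the constant `c m` is `O(q)`, hence zero.
  have hrest : (fun τ ↦ f τ - c m * qParam 1 (τ : ℂ) ^ m) =O[atImInfty]
      fun τ : ℍ ↦ qParam 1 (τ : ℂ) ^ (m + 1) := by
    refine isBigO_qParam_pow_of_hasSum (c := fun i ↦ c i - if i = m then c m else 0)
      (fun τ ↦ ?_) (fun i hi ↦ ?_)
    · have := (hf τ).sub (hasSum_ite_eq m (c m * qParam 1 (τ : ℂ) ^ m))
      refine this.congr_fun fun i ↦ ?_
      by_cases h : i = m <;> simp [h]
    · rcases (Nat.lt_succ_iff.mp hi).lt_or_eq with h | rfl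
      · simp [ih i h (h.trans hm), h.ne]
      · simp
  have hterm : (fun τ : ℍ ↦ c m * qParam 1 (τ : ℂ) ^ m) =O[atImInfty]
      fun τ : ℍ ↦ qParam 1 (τ : ℂ) ^ (m + 1) := by
    simpa using (hO.trans (hpow hm)).sub hrest
  have hconst : (fun _ : ℍ ↦ c m) =O[atImInfty] fun τ : ℍ ↦ qParam 1 (τ : ℂ) := by
    have := hterm.mul (isBigO_refl (fun τ : ℍ ↦ (qParam 1 (τ : ℂ) ^ m)⁻¹) atImInfty)
    refine this.congr (fun τ ↦ ?_) (fun τ ↦ ?_)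
    · field_simp [qParam_ne_zero]
    · field_simp [qParam_ne_zero]
      ring
  exact tendsto_nhds_unique tendsto_const_nhds (hconst.trans_tendsto hqt)

end QExpansionOrder

/-- **Sturm bound.** A modular form of weight `k` for a subgroup `Γ` of finite index in `SL(2, ℤ)`
that is `O(q^n)` at `i∞` for some `n > k [SL(2, ℤ) : Γ] / 12` is identically zero. -/
theorem ModularForm.eq_zero_of_isBigO_qParam_pow {Γ : Subgroup SL(2, ℤ)} [Γ.FiniteIndex] {k : ℤ}
    (f : ModularForm (Γ : Subgroup (GL (Fin 2) ℝ)) k) {n : ℕ}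
    (hO : f =O[atImInfty] fun τ : ℍ ↦ qParam 1 τ ^ n) (hk : 0 ≤ k) (hn : k * Γ.index < 12 * n) :
    f = 0 := by
  -- The norm is the product of the slashes of `f` over all cosets: level one, weight `k` times the
  -- index.
  suffices ModularForm.norm 𝒮ℒ f = 0 by
    rw [ModularForm.norm_eq_zero_iff] at this
    exact DFunLike.coe_injective this
  have hcard : Nat.card (𝒮ℒ ⧸ (Γ : Subgroup (GL (Fin 2) ℝ)).subgroupOf 𝒮ℒ) = Γ.index := by
    change (Γ.map _).relIndex _ = _
    rw [MonoidHom.range_eq_map, ← Subgroup.relIndex_comap,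
      Subgroup.comap_map_eq_self_of_injective Matrix.SpecialLinearGroup.mapGL_injective,
      Subgroup.relIndex_top_right]
  have hnorm : ModularForm.norm 𝒮ℒ f =O[atImInfty] fun τ : ℍ ↦ qParam 1 τ ^ n := by
    let 𝒬 := 𝒮ℒ ⧸ (Γ : Subgroup (GL (Fin 2) ℝ)).subgroupOf 𝒮ℒ
    classical
    let := Fintype.ofFinite 𝒬
    have hprod : ⇑(ModularForm.norm 𝒮ℒ f) = ⇑f * ∏ q ∈ Finset.univ.erase (⟦1⟧ : 𝒬),
        SlashInvariantForm.quotientFunc (ℋ := 𝒮ℒ) f q := by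
      rw [ModularForm.coe_norm]
      refine (Finset.mul_prod_erase Finset.univ _ (Finset.mem_univ (⟦1⟧ : 𝒬))).symm.trans ?_
      simp [𝒬]
    -- The identity coset supplies all the required vanishing; the other factors need only be
    -- bounded.
    have hrest : (∏ q ∈ Finset.univ.erase (⟦1⟧ : 𝒬),
        SlashInvariantForm.quotientFunc (ℋ := 𝒮ℒ) f q) =O[atImInfty] (1 : ℍ → ℝ) := by
      rw [show (1 : ℍ → ℝ) = fun x ↦ ∏ q ∈ Finset.univ.erase (⟦1⟧ : 𝒬), 1 by ext; simp,
        Finset.prod_fn]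
      refine .finsetProd fun q _ ↦ ?_
      induction q using Quotient.inductionOn with | _ r
      have : (Fact (IsCusp .infty (ConjAct.toConjAct (r.val⁻¹)⁻¹ • (Γ : Subgroup (GL (Fin 2) ℝ))))) := by
        refine ⟨?_⟩
        have h : IsCusp .infty 𝒮ℒ := Fact.out
        simpa using h.of_isFiniteRelIndex_conj (𝒢 := (Γ : Subgroup (GL (Fin 2) ℝ))) r.2
      exact ModularFormClass.bdd_at_infty (translate f r.val⁻¹)
    rw [hprod]
    exact (hO.mul (hrest.trans (isBigO_const_const (1 : ℝ) (one_ne_zero (α := ℂ)) atImInfty))).congr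
      (fun _ ↦ rfl) (fun _ ↦ mul_one _)
  apply ModularForm.sturm_bound_levelOne
  refine lt_of_lt_of_le ?_ (PowerSeries.le_order _ n fun i hi ↦ ?_)
  · rw [hcard]
    have h0 : 0 ≤ k * (Γ.index : ℤ) := by positivity
    norm_cast
    omega
  · exact _root_.eq_zero_of_isBigO_qParam_pow
      (fun τ ↦ ModularForm.hasSum_qExpansion _ one_pos (by simp) τ) hnorm (by exact_mod_cast hi)

/-! ### Upper bounds for the index of `Γ₀(N)`. -/

/-- A map to a finite type that separates the right cosets of `H` bounds the index of `H`. -/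
theorem Subgroup.index_le_natCard_of_mul_inv_mem {G X : Type*} [Group G] [Finite X]
    (H : Subgroup G) (φ : G → X) (h : ∀ a b, φ a = φ b → a * b⁻¹ ∈ H) :
    H.index ≤ Nat.card X := by
  refine Nat.card_le_card_of_injective (fun q : G ⧸ H ↦ φ q.out⁻¹) fun q r hqr ↦ ?_
  rw [← q.out_eq', ← r.out_eq', QuotientGroup.eq]
  simpa using h _ _ hqr

namespace CongruenceSubgroup

theorem Gamma0_mem_iff_dvd {N : ℕ} {γ : SL(2, ℤ)} : γ ∈ Gamma0 N ↔ (N : ℤ) ∣ γ 1 0 := by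
  rw [Gamma0_mem, ZMod.intCast_zmod_eq_zero_iff_dvd]

theorem Gamma0_anti {M N : ℕ} (h : M ∣ N) : Gamma0 N ≤ Gamma0 M := fun γ hγ ↦ by
  rw [Gamma0_mem_iff_dvd] at hγ ⊢
  exact (Int.natCast_dvd_natCast.mpr h).trans hγ

/-- The product `γ δ⁻¹` of two elements of `Γ₀(M)` lies in `Γ₀(Mp)` as soon as the bottom rows
`(c, d)`, with `c` divided by `M`, are proportional modulo `p`. -/
theorem mul_inv_mem_Gamma0_mul {M p : ℕ} {γ δ : SL(2, ℤ)} (hγ : γ ∈ Gamma0 M)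
    (hδ : δ ∈ Gamma0 M)
    (h : ((γ 1 0 / M : ℤ) : ZMod p) * (δ 1 1 : ℤ) = ((δ 1 0 / M : ℤ) : ZMod p) * (γ 1 1 : ℤ)) :
    γ * δ⁻¹ ∈ Gamma0 (M * p) := by
  rw [Gamma0_mem_iff_dvd] at hγ hδ ⊢
  have hrow : (γ * δ⁻¹) 1 0 = M * (γ 1 0 / M * δ 1 1 - δ 1 0 / M * γ 1 1) := by
    rw [mul_sub, ← mul_assoc, ← mul_assoc, Int.mul_ediv_cancel' hγ, Int.mul_ediv_cancel' hδ]
    rw [Matrix.SpecialLinearGroup.coe_mul, (Matrix.two_mul_expl _ _).2.2.1]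
    simp [Matrix.SpecialLinearGroup.coe_inv, Matrix.adjugate_fin_two]
    ring
  rw [hrow, Nat.cast_mul]
  refine mul_dvd_mul_left _ ?_
  rw [← ZMod.intCast_zmod_eq_zero_iff_dvd]
  push_cast
  rw [h, sub_self]

/-- Cosets are separated by the point `(c/M : d)` of the projective line over `ZMod p`; `none` is
the point with `d = 0`. -/
theorem index_Gamma0_mul_le (M p : ℕ) [Fact p.Prime] :
    (Gamma0 (M * p)).index ≤ (p + 1) * (Gamma0 M).index := by
  classical
  rw [← Subgroup.relIndex_mul_index (Gamma0_anti (dvd_mul_right M p))]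
  refine Nat.mul_le_mul_right _ ?_
  have hX : Nat.card (Option (ZMod p)) = p + 1 := by simp
  rw [← hX]
  refine Subgroup.index_le_natCard_of_mul_inv_mem _ (fun γ : Gamma0 M ↦
    if ((γ.1 1 1 : ℤ) : ZMod p) = 0 then none
    else some (((γ.1 1 0 / M : ℤ) : ZMod p) / (γ.1 1 1 : ℤ))) fun γ δ h ↦ ?_
  refine mul_inv_mem_Gamma0_mul γ.2 δ.2 ?_
  by_cases h1 : ((γ.1 1 1 : ℤ) : ZMod p) = 0 <;> by_cases h2 : ((δ.1 1 1 : ℤ) : ZMod p) = 0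
  · rw [h1, h2, mul_zero, mul_zero]
  · simp [h1, h2] at h
  · simp [h1, h2] at h
  · simp only [h1, h2, if_false, Option.some.injEq] at h
    exact (div_eq_div_iff h1 h2).mp h

/-- Now `p ∣ c`, so `ad - bc = 1` makes `d` a unit modulo `p`, and the point at infinity does not
occur. -/
theorem index_Gamma0_mul_le_of_dvd {M p : ℕ} [Fact p.Prime] (hp : p ∣ M) :
    (Gamma0 (M * p)).index ≤ p * (Gamma0 M).index := by
  rw [← Subgroup.relIndex_mul_index (Gamma0_anti (dvd_mul_right M p))]
  refine Nat.mul_le_mul_right _ ?_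
  have hunit (γ : Gamma0 M) : ((γ.1 1 1 : ℤ) : ZMod p) ≠ 0 := by
    intro h
    have hc : ((γ.1 1 0 : ℤ) : ZMod p) = 0 := by
      rw [ZMod.intCast_zmod_eq_zero_iff_dvd]
      exact (Int.natCast_dvd_natCast.mpr hp).trans (Gamma0_mem_iff_dvd.mp γ.2)
    have hdet := congrArg (Int.cast : ℤ → ZMod p) (Matrix.det_fin_two γ.1.1 ▸ γ.1.2)
    push_cast at hdet
    rw [h, hc] at hdet
    simp at hdet
  have hX : Nat.card (ZMod p) = p := by simp
  conv_rhs => rw [← hX]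
  refine Subgroup.index_le_natCard_of_mul_inv_mem _ (fun γ : Gamma0 M ↦
    ((γ.1 1 0 / M : ℤ) : ZMod p) / (γ.1 1 1 : ℤ)) fun γ δ h ↦ ?_
  exact mul_inv_mem_Gamma0_mul γ.2 δ.2 ((div_eq_div_iff (hunit γ) (hunit δ)).mp h)

theorem index_Gamma0_48_le : (Gamma0 48).index ≤ 96 := by
  have h1 : (Gamma0 1).index = 1 := by
    rw [Subgroup.index_eq_one]
    exact eq_top_iff.mpr fun γ _ ↦ Gamma0_mem_iff_dvd.mpr (by simp)
  -- The chain of levels 1, 3, 6, 12, 24, 48 contributes the factors 4, 3, 2, 2, 2.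
  have h3 := index_Gamma0_mul_le 1 3
  have h6 := index_Gamma0_mul_le 3 2
  have h12 := index_Gamma0_mul_le_of_dvd (M := 6) (p := 2) (by norm_num)
  have h24 := index_Gamma0_mul_le_of_dvd (M := 12) (p := 2) (by norm_num)
  have h48 := index_Gamma0_mul_le_of_dvd (M := 24) (p := 2) (by norm_num)
  norm_num at h3 h6 h12 h24 h48
  omega

theorem index_Gamma0_144_le : (Gamma0 144).index ≤ 288 := by
  have h144 := index_Gamma0_mul_le_of_dvd (M := 48) (p := 3) (by norm_num)
  have h48 := index_Gamma0_48_le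
  norm_num at h144
  omega

end CongruenceSubgroup

/-! ### Rational translations and their sums. -/

theorem ModularForm.slash_upperRightHom_apply (f : ℍ → ℂ) (k : ℤ) (x : ℝ) (τ : ℍ) :
    (f ∣[k] upperRightHom x) τ = f (x +ᵥ τ) := by
  have h : upperRightHom x • τ = x +ᵥ τ := by
    ext
    simp [σ, num, denom, coe_vadd, UpperHalfPlane.coe_smul, add_comm]
  simp_rw [ModularForm.slash_def, h]
  simp [σ, denom, Matrix.GeneralLinearGroup.val_det_apply]

theorem ModularForm.smul_slash_upperRightHom (f : ℍ → ℂ) (k : ℤ) (x : ℝ) (c : ℂ) :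
    (c • f) ∣[k] upperRightHom x = c • f ∣[k] upperRightHom x := by
  ext τ
  simp [slash_upperRightHom_apply, -Matrix.GeneralLinearGroup.upperRightHom_apply]

theorem isArithmetic_conj_upperRightHom (Γ : Subgroup (GL (Fin 2) ℝ)) [Γ.IsArithmetic] (x : ℚ) :
    (ConjAct.toConjAct (upperRightHom (x : ℝ))⁻¹ • Γ).IsArithmetic := by
  have h : (upperRightHom (-x)).map (Rat.castHom ℝ) = (upperRightHom (x : ℝ))⁻¹ := by
    rw [← AddChar.map_neg_eq_inv]
    ext i j
    fin_cases i <;> fin_cases j <;> simp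
  rw [← h]
  exact Subgroup.IsArithmetic.conj Γ _

namespace CongruenceSubgroup

/-- Conjugating `γ ∈ Γ₀(M P)` by the translation by `j / M` gives an integral matrix with the same
lower left entry, provided that `M ∣ P` and that units modulo `M` are their own inverses. -/
theorem exists_upperRightHom_mul_eq {M P : ℕ} (hM : M ≠ 0) (hMP : M ∣ P)
    (hinv : ∀ x y : ZMod M, x * y = 1 → x = y) {γ : SL(2, ℤ)} (hγ : γ ∈ Gamma0 (M * P)) (j : ℤ) :
    ∃ δ ∈ Gamma0 (M * P), (∃ s : ℤ, δ 1 1 = γ 1 1 + P * s) ∧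
      upperRightHom (j / M : ℝ) * Matrix.SpecialLinearGroup.mapGL ℝ γ =
        Matrix.SpecialLinearGroup.mapGL ℝ δ * upperRightHom (j / M : ℝ) := by
  obtain ⟨R, rfl⟩ := hMP
  obtain ⟨s, hs⟩ := Gamma0_mem_iff_dvd.mp hγ
  have hdet : γ 0 0 * γ 1 1 - γ 0 1 * γ 1 0 = 1 := Matrix.det_fin_two γ.1 ▸ γ.2
  push_cast at hs
  -- The upper right entry of the conjugate contains `j(d - a)/M`. It is integral because `ad ≡ 1`
  -- modulo `M` forces `a ≡ d`.
  obtain ⟨t, ht⟩ : (M : ℤ) ∣ γ 1 1 - γ 0 0 := by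
    rw [← ZMod.intCast_eq_intCast_iff_dvd_sub]
    apply hinv
    have := congrArg (Int.cast : ℤ → ZMod M) hdet
    rw [hs] at this
    push_cast at this
    simpa using this
  have hd : γ 1 1 = γ 0 0 + M * t := by rw [← ht]; ring
  have hMR : (M : ℝ) ≠ 0 := by exact_mod_cast hM
  have hdet' : (γ 0 0 + j * M * R * s) * (γ 1 1 - j * M * R * s) -
      (γ 0 1 + j * t - j ^ 2 * R * s) * (M * (M * R) * s) = 1 := by
    rw [hs, hd] at hdet
    rw [hd]
    linear_combination hdet
  obtain ⟨δ, h00, h01, h10, h11⟩ : ∃ δ : SL(2, ℤ), δ 0 0 = γ 0 0 + j * M * R * s ∧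
      δ 0 1 = γ 0 1 + j * t - j ^ 2 * R * s ∧ δ 1 0 = M * (M * R) * s ∧
      δ 1 1 = γ 1 1 - j * M * R * s :=
    ⟨⟨!![γ 0 0 + j * M * R * s, γ 0 1 + j * t - j ^ 2 * R * s;
      M * (M * R) * s, γ 1 1 - j * M * R * s], (Matrix.det_fin_two_of _ _ _ _).trans hdet'⟩,
      rfl, rfl, rfl, rfl⟩
  refine ⟨δ, Gamma0_mem_iff_dvd.mpr ⟨s, by rw [h10]; push_cast; ring⟩,
    ⟨-j * s, by rw [h11]; push_cast; ring⟩, ?_⟩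
  ext i l
  fin_cases i <;> fin_cases l <;>
    simp [Matrix.mul_apply, Fin.sum_univ_two, h00, h01, h10, h11, hs, hd] <;> field_simp <;> ring

end CongruenceSubgroup

section TranslateSum

variable {Γ : Subgroup (GL (Fin 2) ℝ)} {k : ℤ}

/-- The weighted sum `∑ j, w j * f(z + j / M)` of translates of a function on `ℍ`. -/
noncomputable def translateSum (k : ℤ) (M : ℕ) (w : ℕ → ℂ) (f : ℍ → ℂ) : ℍ → ℂ :=
  ∑ j ∈ Finset.range M, w j • f ∣[k] upperRightHom (j / M : ℝ)

theorem translateSum_apply (M : ℕ) (w : ℕ → ℂ) (f : ℍ → ℂ) (τ : ℍ) :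
    translateSum k M w f τ = ∑ j ∈ Finset.range M, w j * f ((j / M : ℝ) +ᵥ τ) := by
  simp [translateSum, ModularForm.slash_upperRightHom_apply,
    -Matrix.GeneralLinearGroup.upperRightHom_apply]

open scoped Manifold in
theorem mdifferentiable_translateSum (M : ℕ) (w : ℕ → ℂ) (f : ModularForm Γ k) :
    MDiff (translateSum k M w f) :=
  .sum fun _ _ ↦ (f.holo'.slash k _).const_smul _

/-- Each translate is modular for a conjugate of `Γ` by a rational matrix, which is again arithmetic
and so has the same cusps. -/
theorem isBoundedAt_translateSum [Γ.IsArithmetic] (M : ℕ) (w : ℕ → ℂ) (f : ModularForm Γ k)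
    {c : OnePoint ℝ} (hc : IsCusp c 𝒮ℒ) : c.IsBoundedAt (translateSum k M w f) k := by
  unfold translateSum
  refine Finset.sum_induction _ (fun g : ℍ → ℂ ↦ c.IsBoundedAt g k)
    (fun _ _ ↦ OnePoint.IsBoundedAt.add) ?_ fun j _ ↦ ?_
  · intro g _
    simpa using zero_form_isBoundedAtImInfty
  · have := isArithmetic_conj_upperRightHom Γ (j / M)
    have hc' : IsCusp c (ConjAct.toConjAct (upperRightHom (((j / M : ℚ) : ℝ)))⁻¹ • Γ) := by
      rwa [Subgroup.IsArithmetic.isCusp_iff_isCusp_SL2Z]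
    intro g hg
    have hb : IsBoundedAtImInfty ((f ∣[k] upperRightHom ((j / M : ℚ) : ℝ)) ∣[k] g) :=
      (ModularForm.translate f (upperRightHom ((j / M : ℚ) : ℝ))).bdd_at_cusps' hc' g hg
    rw [ModularForm.smul_slash]
    refine IsBigO.const_smul_left ?_ _
    rwa [Rat.cast_div, Rat.cast_natCast, Rat.cast_natCast] at hb

/-- Moving `γ` past a translation changes its lower right entry by a multiple of `P`, which `χ` does
not see by `hχ`. -/
theorem translateSum_slash {L M P : ℕ} (hM : M ≠ 0) (hMP : M ∣ P) (hL : L ∣ M * P)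
    (hinv : ∀ x y : ZMod M, x * y = 1 → x = y) {χ : DirichletCharacter ℂ L}
    (hχ : ∀ x y : ℤ, χ ((x + P * y : ℤ) : ZMod L) = χ (x : ZMod L)) {f : ℍ → ℂ}
    (hf : ∀ γ ∈ CongruenceSubgroup.Gamma0 L, f ∣[k] γ = χ ((γ 1 1 : ℤ) : ZMod L) • f)
    (w : ℕ → ℂ) {γ : SL(2, ℤ)} (hγ : γ ∈ CongruenceSubgroup.Gamma0 (M * P)) :
    translateSum k M w f ∣[k] γ = χ ((γ 1 1 : ℤ) : ZMod L) • translateSum k M w f := by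
  rw [translateSum, Finset.smul_sum, SlashAction.sum_slash]
  refine Finset.sum_congr rfl fun j _ ↦ ?_
  obtain ⟨δ, hδ, ⟨s, hs⟩, hconj⟩ :=
    CongruenceSubgroup.exists_upperRightHom_mul_eq hM hMP hinv hγ j
  rw [Int.cast_natCast] at hconj
  rw [ModularForm.SL_smul_slash]
  change w j • (f ∣[k] upperRightHom (j / M : ℝ)) ∣[k] Matrix.SpecialLinearGroup.mapGL ℝ γ = _
  have hδf : f ∣[k] Matrix.SpecialLinearGroup.mapGL ℝ δ = χ ((δ 1 1 : ℤ) : ZMod L) • f :=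
    hf δ (CongruenceSubgroup.Gamma0_anti hL hδ)
  rw [← SlashAction.slash_mul, hconj, SlashAction.slash_mul, hδf, hs, hχ, ModularForm.smul_slash_upperRightHom,
    smul_comm]

end TranslateSum

/-! ### Extraction of a residue class of coefficients. -/

section Coefficients

variable {k : ℤ}

theorem qParam_vadd_natCast_div (M j : ℕ) (τ : ℍ) :
    qParam 1 (((j / M : ℝ) +ᵥ τ : ℍ) : ℂ) =
      Complex.exp (2 * Real.pi * Complex.I / M) ^ j * qParam 1 (τ : ℂ) := by
  rw [qParam, qParam, ← Complex.exp_nat_mul, ← Complex.exp_add, coe_vadd]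
  congr 1
  push_cast
  ring

/-- The weights `e(-j r / M)`, for which `translateSum` extracts, up to the factor `M`, the
coefficients in degrees `≡ r` modulo `M`. -/
noncomputable def residueWeight (M r : ℕ) (j : ℕ) : ℂ :=
  ((Complex.exp (2 * Real.pi * Complex.I / M) ^ r)⁻¹) ^ j

theorem sum_residueWeight_mul_pow {M : ℕ} (hM : M ≠ 0) (r m : ℕ) :
    ∑ j ∈ Finset.range M,
        residueWeight M r j * (Complex.exp (2 * Real.pi * Complex.I / M) ^ j) ^ m =
      if m ≡ r [MOD M] then (M : ℂ) else 0 := by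
  have hζ := Complex.isPrimitiveRoot_exp M hM
  set ζ := Complex.exp (2 * Real.pi * Complex.I / M) with hζdef
  have hζ0 : ζ ≠ 0 := Complex.exp_ne_zero _
  have hsum : ∑ j ∈ Finset.range M, residueWeight M r j * (ζ ^ j) ^ m =
      ∑ j ∈ Finset.range M, ((ζ ^ r)⁻¹ * ζ ^ m) ^ j :=
    Finset.sum_congr rfl fun j _ ↦ by
      rw [residueWeight, ← hζdef, mul_pow, ← pow_mul ζ m, mul_comm m j, pow_mul]
  have hiff : (ζ ^ r)⁻¹ * ζ ^ m = 1 ↔ m ≡ r [MOD M] := by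
    rw [inv_mul_eq_one₀ (pow_ne_zero _ hζ0), eq_comm, hζ.eq_orderOf]
    have := pow_eq_pow_iff_modEq (x := Units.mk0 ζ hζ0) (n := m) (m := r)
    rw [← orderOf_units, Units.val_mk0, Units.ext_iff] at this
    simpa using this
  rw [hsum]
  split_ifs with h
  · simp [hiff.mpr h]
  -- The ratio is an `M`-th root of unity other than `1`, so the geometric sum vanishes.
  · rw [geom_sum_eq (mt hiff.mp h), mul_pow, inv_pow, ← pow_mul, ← pow_mul, mul_comm r,
      mul_comm m, pow_mul, pow_mul, hζ.pow_eq_one]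
    simp

theorem hasSum_translateSum_residueWeight {M : ℕ} (hM : M ≠ 0) (r : ℕ) {f : ℍ → ℂ} {c : ℕ → ℂ}
    (hf : ∀ τ : ℍ, HasSum (fun m ↦ c m * qParam 1 τ ^ m) (f τ)) (τ : ℍ) :
    HasSum (fun m ↦ (if m ≡ r [MOD M] then M * c m else 0) * qParam 1 τ ^ m)
      (translateSum k M (residueWeight M r) f τ) := by
  rw [translateSum_apply]
  refine (hasSum_sum fun (j : ℕ) _ ↦ (hf ((j / M : ℝ) +ᵥ τ)).mul_left (residueWeight M r j)).congr_fun
    fun m ↦ ?_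
  have h := sum_residueWeight_mul_pow hM r m
  rw [show (if m ≡ r [MOD M] then M * c m else 0) = (if m ≡ r [MOD M] then (M : ℂ) else 0) * c m by
    split_ifs <;> simp, ← h, Finset.sum_mul, Finset.sum_mul]
  refine Finset.sum_congr rfl fun j _ ↦ ?_
  rw [qParam_vadd_natCast_div, mul_pow]
  ring

end Coefficients

/-! ### Squaring away the character, and the Sturm bound in progressions. -/

theorem apply_mul_self_eq_one_of_mem_Gamma0 {L : ℕ} {χ : DirichletCharacter ℂ L} (hχ : χ ^ 2 = 1)
    {γ : SL(2, ℤ)} (hγ : γ ∈ CongruenceSubgroup.Gamma0 L) :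
    χ ((γ 1 1 : ℤ) : ZMod L) * χ ((γ 1 1 : ℤ) : ZMod L) = 1 := by
  have hdet := congrArg (Int.cast : ℤ → ZMod L) (Matrix.det_fin_two γ.1 ▸ γ.2)
  push_cast at hdet
  rw [CongruenceSubgroup.Gamma0_mem.mp hγ, mul_zero, sub_zero, mul_comm] at hdet
  rw [← MulChar.mul_apply, ← sq, hχ, MulChar.one_apply (IsUnit.of_mul_eq_one _ hdet)]

/-- The square of a weighted sum of translates of `f ∈ M_k(Γ₀(L), χ)`, for `χ` quadratic, as a
modular form of weight `2k` for `Γ₀(M P)`. -/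
noncomputable def translateSumSq {L M P : ℕ} [NeZero L] [NeZero P] [NeZero M] (hMP : M ∣ P)
    (hL : L ∣ M * P) (hinv : ∀ x y : ZMod M, x * y = 1 → x = y) {χ : DirichletCharacter ℂ L}
    (hχ : ∀ x y : ℤ, χ ((x + P * y : ℤ) : ZMod L) = χ (x : ZMod L)) (hχ2 : χ ^ 2 = 1)
    {k : ℤ} (f : ModularForm (CongruenceSubgroup.Gamma1 L : Subgroup (GL (Fin 2) ℝ)) k)
    (hf : ∀ γ ∈ CongruenceSubgroup.Gamma0 L, ⇑f ∣[k] γ = χ ((γ 1 1 : ℤ) : ZMod L) • ⇑f)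
    (w : ℕ → ℂ) :
    ModularForm (CongruenceSubgroup.Gamma0 (M * P) : Subgroup (GL (Fin 2) ℝ)) (k + k) where
  toFun := translateSum k M w f * translateSum k M w f
  slash_action_eq' := by
    rintro _ ⟨γ, hγ, rfl⟩
    change (translateSum k M w f * translateSum k M w f) ∣[k + k] γ = _
    have hunit := apply_mul_self_eq_one_of_mem_Gamma0 hχ2 (CongruenceSubgroup.Gamma0_anti hL hγ)
    rw [ModularForm.mul_slash_SL2, translateSum_slash (NeZero.ne M) hMP hL hinv hχ hf w hγ,
      smul_mul_smul_comm, hunit, one_smul]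
  holo' := (mdifferentiable_translateSum M w f).mul (mdifferentiable_translateSum M w f)
  bdd_at_cusps' := by
    intro c hc γ hγ
    have hb := isBoundedAt_translateSum M w f
      (Subgroup.IsArithmetic.isCusp_iff_isCusp_SL2Z _ |>.mp hc) γ hγ
    rw [ModularForm.mul_slash]
    exact (BoundedAtFilter.mul hb hb).smul _

theorem coe_translateSumSq {L M P : ℕ} [NeZero L] [NeZero P] [NeZero M] (hMP : M ∣ P)
    (hL : L ∣ M * P) (hinv : ∀ x y : ZMod M, x * y = 1 → x = y) {χ : DirichletCharacter ℂ L}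
    (hχ : ∀ x y : ℤ, χ ((x + P * y : ℤ) : ZMod L) = χ (x : ZMod L)) (hχ2 : χ ^ 2 = 1)
    {k : ℤ} (f : ModularForm (CongruenceSubgroup.Gamma1 L : Subgroup (GL (Fin 2) ℝ)) k)
    (hf : ∀ γ ∈ CongruenceSubgroup.Gamma0 L, ⇑f ∣[k] γ = χ ((γ 1 1 : ℤ) : ZMod L) • ⇑f)
    (w : ℕ → ℂ) :
    ⇑(translateSumSq hMP hL hinv hχ hχ2 f hf w) =
      translateSum k M w f * translateSum k M w f := rfl

open LevelFortyEight in
/-- **Sturm bound for an arithmetic progression.** If `f ∈ S_k(Γ₀(L), χ)` with `χ` quadratic has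
vanishing coefficients in all degrees `n < B` with `n ≡ r` modulo `M`, and `B` is larger than
`k [SL(2, ℤ) : Γ₀(N)] / 12` for a suitable multiple `N = M P` of `L`, then all its coefficients in
degrees `n ≡ r` modulo `M` vanish. -/
theorem coeff_eq_zero_of_modEq {L M P : ℕ} [NeZero L] [NeZero P] [NeZero M] (hMP : M ∣ P)
    (hL : L ∣ M * P) (hinv : ∀ x y : ZMod M, x * y = 1 → x = y) {χ : DirichletCharacter ℂ L}
    (hχ : ∀ x y : ℤ, χ ((x + P * y : ℤ) : ZMod L) = χ (x : ZMod L)) (hχ2 : χ ^ 2 = 1)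
    {k : ℤ} (hk : 0 ≤ k)
    {f : CuspForm (CongruenceSubgroup.Gamma1 L : Subgroup (GL (Fin 2) ℝ)) k}
    (hf : f ∈ cuspFormsWithCharacter L k χ) {r B : ℕ}
    (hB : k * (CongruenceSubgroup.Gamma0 (M * P)).index < 12 * B)
    (h : ∀ n < B, n ≡ r [MOD M] → qCoeff f n = 0) {n : ℕ} (hn : n ≡ r [MOD M]) :
    qCoeff f n = 0 := by
  have hM : M ≠ 0 := NeZero.ne M
  have hsum : ∀ τ : ℍ, HasSum (fun m ↦ qCoeff f m * qParam 1 τ ^ m) (f τ) :=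
    fun τ ↦ ModularForm.hasSum_qExpansion f one_pos (by simp) τ
  have hproj := hasSum_translateSum_residueWeight (k := k) hM r hsum
  set g := translateSum k M (residueWeight M r) f with hg
  have hgO : g =O[atImInfty] fun τ : ℍ ↦ qParam 1 (τ : ℂ) ^ B :=
    isBigO_qParam_pow_of_hasSum hproj fun m hm ↦ by
      split_ifs with hmr
      · rw [h m hm hmr, mul_zero]
      · rfl
  let G := translateSumSq hMP hL hinv hχ hχ2 (ModularFormClass.modularForm f) hf
    (residueWeight M r)
  have hGg : ⇑G = g * g := coe_translateSumSq ..
  have hG : G = 0 := by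
    -- Squaring doubles both the weight and the order of vanishing, so the numerical condition is
    -- still `hB`.
    refine ModularForm.eq_zero_of_isBigO_qParam_pow G (n := B + B) ?_ (by positivity) ?_
    · rw [hGg]
      exact (hgO.mul hgO).congr_right fun τ ↦ (pow_add _ _ _).symm
    · push_cast
      linarith
  have hg0 : g = 0 := by
    ext τ
    have : (g * g) τ = 0 := by rw [← hGg, hG]; rfl
    simpa using this
  have := eq_zero_of_isBigO_qParam_pow hproj (n := n + 1)
    (by rw [hg0]; exact isBigO_zero _ _) n.lt_succ_self
  rw [if_pos hn] at this
  exact (mul_eq_zero.mp this).resolve_left (Nat.cast_ne_zero.mpr hM)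

/-! ### The characters and numerical bounds at level 48. -/

namespace LevelFortyEight

theorem chi3_sq : chi3 ^ 2 = 1 := by
  rw [chi3, ← map_pow, ((quadraticChar_isQuadratic (ZMod 3)).comp _).sq_eq_one, map_one]

theorem chi4_sq : chi4 ^ 2 = 1 := by
  rw [chi4, ← map_pow, (ZMod.isQuadratic_χ₄.comp _).sq_eq_one, map_one]

theorem chi4_add_twelve_mul (x y : ℤ) :
    chi4 ((x + (12 : ℕ) * y : ℤ) : ZMod 48) = chi4 (x : ZMod 48) := by
  have hcop : IsCoprime (x + (12 : ℕ) * y) ((48 : ℕ) : ℤ) ↔ IsCoprime x ((48 : ℕ) : ℤ) := by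
    have h48 : ((48 : ℕ) : ℤ) = 12 * 4 := by norm_num
    have h4 (z : ℤ) : IsCoprime z 12 → IsCoprime z 4 :=
      fun h ↦ h.of_isCoprime_of_dvd_right (by norm_num)
    have h12 (z : ℤ) : IsCoprime z ((48 : ℕ) : ℤ) ↔ IsCoprime z 12 := by
      rw [h48, IsCoprime.mul_right_iff]
      exact ⟨fun h ↦ h.1, fun h ↦ ⟨h, h4 z h⟩⟩
    rw [h12, h12]
    exact IsCoprime.add_mul_left_left_iff
  by_cases hx : IsCoprime x ((48 : ℕ) : ℤ)
  · rw [chi4, DirichletCharacter.changeLevel_eq_cast_of_dvd' _ _ (hcop.mpr hx),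
      DirichletCharacter.changeLevel_eq_cast_of_dvd' _ _ hx]
    have h12 : (12 : ZMod 4) = 0 := rfl
    push_cast
    rw [h12, zero_mul, add_zero]
  · have hx' : ¬ IsCoprime (x + (12 : ℕ) * y) ((48 : ℕ) : ℤ) := mt hcop.mp hx
    rw [isCoprime_comm, ← ZMod.coe_int_isUnit_iff_isCoprime] at hx hx'
    rw [chi4, MulChar.map_nonunit _ hx, MulChar.map_nonunit _ hx']

variable {f g : CuspForm (CongruenceSubgroup.Gamma1 48 : Subgroup (GL (Fin 2) ℝ)) 3}

theorem qCoeff_add (n : ℕ) : qCoeff (f + g) n = qCoeff f n + qCoeff g n := by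
  rw [qCoeff, FunLike.coe_add, ModularForm.qExpansion_add one_pos (by simp) f g, map_add]
  rfl

theorem add_mem_cuspFormsWithCharacter {χ : DirichletCharacter ℂ 48}
    (hf : f ∈ cuspFormsWithCharacter 48 3 χ) (hg : g ∈ cuspFormsWithCharacter 48 3 χ) :
    f + g ∈ cuspFormsWithCharacter 48 3 χ := fun γ hγ ↦ by
  rw [FunLike.coe_add, SlashAction.add_slash, hf γ hγ, hg γ hγ, smul_add]

theorem qCoeff_eq_zero_of_modEq_three (hf : f ∈ cuspFormsWithCharacter 48 3 chi3) {r : ℕ}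
    (h : ∀ n < 73, n ≡ r [MOD 3] → qCoeff f n = 0) {n : ℕ} (hn : n ≡ r [MOD 3]) :
    qCoeff f n = 0 := by
  -- The conditions `3 ∣ P` and `48 ∣ 3P` force `48 ∣ P`, hence level 144; then `3·288 < 12·73`.
  refine coeff_eq_zero_of_modEq (M := 3) (P := 48) (by norm_num) (by norm_num) (by decide)
    (fun x y ↦ ?_) chi3_sq (by norm_num) hf ?_ h hn
  · have h48 : ((48 : ℕ) : ZMod 48) = 0 := rfl
    rw [Int.cast_add, Int.cast_mul, Int.cast_natCast, h48, zero_mul, add_zero]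
  · have := CongruenceSubgroup.index_Gamma0_144_le
    norm_num
    omega

theorem qCoeff_eq_zero_of_modEq_four (hf : f ∈ cuspFormsWithCharacter 48 3 chi4) {r : ℕ}
    (h : ∀ n < 25, n ≡ r [MOD 4] → qCoeff f n = 0) {n : ℕ} (hn : n ≡ r [MOD 4]) :
    qCoeff f n = 0 := by
  -- Since `chi4` has period 12, the level stays 48, and `3·96 < 12·25`.
  refine coeff_eq_zero_of_modEq (M := 4) (P := 12) (by norm_num) (by norm_num) (by decide)
    chi4_add_twelve_mul chi4_sq (by norm_num) hf ?_ h hn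
  have := CongruenceSubgroup.index_Gamma0_48_le
  norm_num
  omega

end LevelFortyEight

theorem proposition5p1
    (f20 f22 f35 f38 f41 f44 :
      CuspForm (CongruenceSubgroup.Gamma1 48 : Subgroup (GL (Fin 2) ℝ)) 3)
    (h20 : LevelFortyEight.IsCuspFormWithExpansion
      LevelFortyEight.chi3 LevelFortyEight.coeffs20 f20)
    (h22 : LevelFortyEight.IsCuspFormWithExpansion
      LevelFortyEight.chi3 LevelFortyEight.coeffs22 f22)
    (h35 : LevelFortyEight.IsCuspFormWithExpansion
      LevelFortyEight.chi4 LevelFortyEight.coeffs35 f35)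
    (h38 : LevelFortyEight.IsCuspFormWithExpansion
      LevelFortyEight.chi4 LevelFortyEight.coeffs38 f38)
    (h41 : LevelFortyEight.IsCuspFormWithExpansion
      LevelFortyEight.chi4 LevelFortyEight.coeffs41 f41)
    (h44 : LevelFortyEight.IsCuspFormWithExpansion
      LevelFortyEight.chi4 LevelFortyEight.coeffs44 f44) :
    (∀ n : ℕ, n ≡ 1 [MOD 4] → LevelFortyEight.qCoeff f44 n = 0) ∧
    (∀ n : ℕ, ¬ n ≡ 1 [MOD 4] → LevelFortyEight.qCoeff f41 n = 0) ∧
    (∀ n : ℕ, n ≡ 1 [MOD 4] →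
      LevelFortyEight.qCoeff f35 n = -LevelFortyEight.qCoeff f38 n) ∧
    (∀ n : ℕ, n ≡ 1 [MOD 3] → LevelFortyEight.qCoeff f22 n = 0) ∧
    (∀ n : ℕ, n ≡ 2 [MOD 3] → LevelFortyEight.qCoeff f20 n = 0) := by
  refine ⟨fun n hn ↦ ?_, fun n hn ↦ ?_, fun n hn ↦ ?_, fun n hn ↦ ?_, fun n hn ↦ ?_⟩
  · refine LevelFortyEight.qCoeff_eq_zero_of_modEq_four h44.1 (fun m hm hmr ↦ ?_) hn
    have hL : ∀ (m : ℕ) (hm : m < 25), m % 4 = 1 → LevelFortyEight.coeffs44[m] = 0 := by decide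
    rw [h44.2 m hm, hL m hm hmr, Int.cast_zero]
  -- Taking `r = n` treats the three remaining classes modulo 4 at once.
  · refine LevelFortyEight.qCoeff_eq_zero_of_modEq_four h41.1 (fun m hm hmr ↦ ?_) (Nat.ModEq.refl n)
    have hL : ∀ (m : ℕ) (hm : m < 25), m % 4 ≠ 1 → LevelFortyEight.coeffs41[m] = 0 := by decide
    rw [h41.2 m hm, hL m hm fun h ↦ hn (hmr.symm.trans h), Int.cast_zero]
  · rw [eq_neg_iff_add_eq_zero, ← LevelFortyEight.qCoeff_add]
    refine LevelFortyEight.qCoeff_eq_zero_of_modEq_four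
      (LevelFortyEight.add_mem_cuspFormsWithCharacter h35.1 h38.1) (fun m hm hmr ↦ ?_) hn
    have hL : ∀ (m : ℕ) (hm : m < 25), m % 4 = 1 →
        LevelFortyEight.coeffs35[m] + LevelFortyEight.coeffs38[m]'hm = 0 := by decide
    rw [LevelFortyEight.qCoeff_add, h35.2 m hm, h38.2 m hm, ← Int.cast_add, hL m hm hmr,
      Int.cast_zero]
  · refine LevelFortyEight.qCoeff_eq_zero_of_modEq_three h22.1 (fun m hm hmr ↦ ?_) hn
    have hL : ∀ (m : ℕ) (hm : m < 73), m % 3 = 1 → LevelFortyEight.coeffs22[m] = 0 := by decide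
    rw [h22.2 m hm, hL m hm hmr, Int.cast_zero]
  · refine LevelFortyEight.qCoeff_eq_zero_of_modEq_three h20.1 (fun m hm hmr ↦ ?_) hn
    have hL : ∀ (m : ℕ) (hm : m < 73), m % 3 = 2 → LevelFortyEight.coeffs20[m] = 0 := by decide
    rw [h20.2 m hm, hL m hm hmr, Int.cast_zero]
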